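/- Let $M,N>1$ be integers with $M\ne N$, let $J\ge 0$ be an integer, $a>0$ real, $b\in\mathbb C$ with $\operatorname{Re} b>-Ja-1$, and $z\in\mathbb R$. For an integer $K>1$ and $w>0$ put $$\Phi_{a,b,K,J}(w)=(-1)^J\frac{d^J}{dw^J}\sum_{n\ge1}\sum_{k=1}^{K-1}\Bigl[(Kn-k)^b e^{-w(Kn-k)^a}-(Kn)^b e^{-w(Kn)^a}\Bigr],$$ where $x^y=e^{y\ln x}$ for $x>0$. Then $$\sum_{n\in\mathbb Z}\Bigl(\frac MN\Bigr)^{(aJ+1+b)(n+z)}\Bigl[\Phi_{a,b,M,J}\Bigl(\Bigl(\tfrac MN\Bigr)^{a(z+n)}\Bigr)-\Phi_{a,b,N,J}\Bigl(\Bigl(\tfrac MN\Bigr)^{a(z+n)}\Bigr)\Bigr]=\operatorname{sgn}(M-N)\,\frac{\Gamma\bigl(\frac{1+b}{a}+J\bigr)}{a},$$ the series over $n\in\mathbb Z$ being unconditionally (absolutely) convergent. In particular the right-hand side is $\Gamma\bigl(\frac{1+b}{a}+J\bigr)/a$ when $M>N$. As a special case ($a=1$, $b=0$), for integers $M>N>1$,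 $J\ge0$ and real $w$, with $$\varphi_{J,M,N}(t)=(-1)^J\frac{d^J}{dt^J}\Bigl(\frac{N}{e^{Nt}-1}-\frac{M}{e^{Mt}-1}\Bigr)\qquad(t>0),$$ one has, again with unconditional convergence, $$\sum_{n\in\mathbb Z}\Bigl(\frac MN\Bigr)^{(J+1)(n+w)}\varphi_{J,M,N}\Bigl(\Bigl(\tfrac MN\Bigr)^{n+w}\Bigr)=J!.$$ -/

import Mathlib

/-- The series
`∑_{n ≥ 1} ∑_{k=1}^{M-1} [(Mn-k)^b e^{-w (Mn-k)^a} - (Mn)^b e^{-w (Mn)^a}]`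
for real `w` (it converges for `w > 0`); the index `n ≥ 1` is written `n + 1` with `n : ℕ`. -/
noncomputable def phiSeries (a : ℝ) (b : ℂ) (M : ℕ) (w : ℝ) : ℂ :=
  ∑' n : ℕ, ∑ k ∈ Finset.Icc 1 (M - 1),
    (((M : ℂ) * ((n : ℂ) + 1) - (k : ℂ)) ^ b
        * (Real.exp (-w * ((M : ℝ) * ((n : ℝ) + 1) - (k : ℝ)) ^ a) : ℂ)
      - ((M : ℂ) * ((n : ℂ) + 1)) ^ b
        * (Real.exp (-w * ((M : ℝ) * ((n : ℝ) + 1)) ^ a) : ℂ))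

/-- `Φ_{a,b,M,J}(w) = (-1)^J (d/dw)^J` of the series above, for `w > 0`. -/
noncomputable def Phi (a : ℝ) (b : ℂ) (M J : ℕ) (w : ℝ) : ℂ :=
  (-1) ^ J * iteratedDeriv J (phiSeries a b M) w

/-- `φ_{J,M,N}(w) = (-1)^J (d/dw)^J (N / (e^{Nw} - 1) - M / (e^{Mw} - 1))`, for `w > 0`. -/
noncomputable def phiExp (J M N : ℕ) (w : ℝ) : ℝ :=
  (-1) ^ J * iteratedDeriv J
    (fun t : ℝ => (N : ℝ) / (Real.exp ((N : ℝ) * t) - 1)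
      - (M : ℝ) / (Real.exp ((M : ℝ) * t) - 1)) w

/-! ### The function `t ^ c * exp (-t ^ a)` and its sums over positive integers. -/

section PowerExponentialSums

open Set Filter Topology MeasureTheory

/-! Put `c = b + J a`, `f(t) = t ^ c * exp (-t ^ a)`, and let `L(x) = ∑ x f(x m)`, over `m ≥ 1`, be
the Riemann sum of `f` with step `x`. Completing residue blocks mod `K` and differentiating gives
`Φ_K(w) = S(w) - K ^ (1 + c) S(K ^ a w)` with `S = powExpSeries a c` (`Phi_eq_sub`). At `w = v ^ a`,
multiplication by `v ^ (c + 1)` turns `Φ_M - Φ_N` into `L(N v) - L(M v)` (`cpow_mul_Phi_sub_Phi`).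

For `v = (M/N) ^ (n + z)` the series therefore telescopes along a geometric progression, and its sum
is, up to sign, the limit of `L` at `0` minus that at `∞`. The first is `∫ f = Γ((1 + c)/a)/a`, the
second is `0`. The rates `O(x ^ ε)` and `O(1/x)` make the convergence unconditional
(`hasSum_sub_succ_geometric`). -/

/-- The function `t ↦ t ^ c * exp (-t ^ a)`. -/
noncomputable def powExp (a : ℝ) (c : ℂ) (t : ℝ) : ℂ :=
  (t : ℂ) ^ c * (Real.exp (-t ^ a) : ℂ)

/-- The derivative of `powExp a c` at positive reals. -/
noncomputable def powExpDeriv (a : ℝ) (c : ℂ) (t : ℝ) : ℂ :=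
  c * powExp a (c - 1) t - (a : ℂ) * powExp a (c + a - 1) t

/-- The `m`-th term (starting with `1`) of the series `∑ m ^ c * exp (-w * m ^ a)`. -/
noncomputable def powExpTerm (a : ℝ) (c : ℂ) (w : ℝ) (m : ℕ) : ℂ :=
  ((m : ℂ) + 1) ^ c * (Real.exp (-w * ((m : ℝ) + 1) ^ a) : ℂ)

/-- The series `∑ m ^ c * exp (-w * m ^ a)` over positive integers `m`. -/
noncomputable def powExpSeries (a : ℝ) (c : ℂ) (w : ℝ) : ℂ :=
  ∑' m : ℕ, powExpTerm a c w m

theorem norm_powExp {a : ℝ} {c : ℂ} {t : ℝ} (ht : 0 < t) :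
    ‖powExp a c t‖ = t ^ c.re * Real.exp (-t ^ a) := by
  rw [powExp, norm_mul, Complex.norm_cpow_eq_rpow_re_of_pos ht, Complex.norm_real,
    Real.norm_of_nonneg (Real.exp_pos _).le]

theorem hasDerivAt_powExp {a : ℝ} {c : ℂ} {t : ℝ} (ht : 0 < t) :
    HasDerivAt (powExp a c) (powExpDeriv a c t) t := by
  have htc : (t : ℂ) ≠ 0 := by exact_mod_cast ht.ne'
  have h1 : HasDerivAt (fun x : ℝ => (x : ℂ) ^ c) (c * (t : ℂ) ^ (c - 1)) t := by
    have h := (hasDerivAt_id (t : ℂ)).cpow_const (c := c)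
      (Complex.ofReal_mem_slitPlane.2 ht)
    simpa using h.comp_ofReal
  have h2 : HasDerivAt (fun x : ℝ => Real.exp (-x ^ a))
      (Real.exp (-t ^ a) * (-(a * t ^ (a - 1)))) t :=
    ((Real.hasDerivAt_rpow_const (Or.inl ht.ne')).neg).exp
  refine (h1.mul h2.ofReal_comp).congr_deriv ?_
  have h3 : ((t ^ (a - 1) : ℝ) : ℂ) = (t : ℂ) ^ ((a : ℂ) - 1) := by
    rw [Complex.ofReal_cpow ht.le]; push_cast; rfl
  have h4 : (t : ℂ) ^ (c + a - 1) = (t : ℂ) ^ c * (t : ℂ) ^ ((a : ℂ) - 1) := by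
    rw [← Complex.cpow_add _ _ htc, add_sub_assoc]
  rw [powExpDeriv, powExp, powExp, h4, Complex.ofReal_mul, Complex.ofReal_neg,
    Complex.ofReal_mul, h3]
  ring

theorem continuousOn_powExp (a : ℝ) (c : ℂ) : ContinuousOn (powExp a c) (Ioi 0) :=
  fun _ ht => (hasDerivAt_powExp ht).continuousAt.continuousWithinAt

theorem integrableOn_powExp {a : ℝ} {c : ℂ} (ha : 0 < a) (hc : -1 < c.re) :
    IntegrableOn (powExp a c) (Ioi 0) := by
  refine Integrable.mono' (integrableOn_rpow_mul_exp_neg_rpow hc ha)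
    ((continuousOn_powExp a c).aestronglyMeasurable measurableSet_Ioi) ?_
  filter_upwards [ae_restrict_mem measurableSet_Ioi] with t ht
  exact (norm_powExp ht).le

/-- Substitute `t ^ a` for the variable in Euler's integral. -/
theorem integral_powExp {a : ℝ} {c : ℂ} (ha : 0 < a) (hc : -1 < c.re) :
    ∫ t in Ioi 0, powExp a c t = Complex.Gamma ((1 + c) / a) / a := by
  have hac : (a : ℂ) ≠ 0 := by exact_mod_cast ha.ne'
  have hs : 0 < ((1 + c) / (a : ℂ)).re := by
    rw [Complex.div_ofReal_re]
    exact div_pos (by simp; linarith) ha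
  rw [Complex.Gamma_eq_integral hs, Complex.GammaIntegral, ← integral_comp_rpow_Ioi (fun x : ℝ => ((Real.exp (-x) : ℝ) : ℂ) * (x : ℂ) ^ ((1 + c) / (a : ℂ) - 1))
      ha.ne', eq_div_iff hac, ← integral_mul_const]
  refine setIntegral_congr_fun measurableSet_Ioi fun t ht => ?_
  have ht : 0 < t := ht
  have htc : (t : ℂ) ≠ 0 := by exact_mod_cast ht.ne'
  have h1 : ((t ^ a : ℝ) : ℂ) ^ ((1 + c) / (a : ℂ) - 1) = (t : ℂ) ^ (1 + c - a) := by
    have hta : ((t ^ a : ℝ) : ℂ) ≠ 0 := by exact_mod_cast (Real.rpow_pos_of_pos ht a).ne'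
    rw [Complex.cpow_def_of_ne_zero hta, Complex.cpow_def_of_ne_zero htc, ← Complex.ofReal_log ht.le,
      ← Complex.ofReal_log (Real.rpow_nonneg ht.le a), Real.log_rpow ht]
    congr 1
    push_cast
    field_simp
  have h2 : (t : ℂ) ^ c = (t : ℂ) ^ ((a : ℂ) - 1) * (t : ℂ) ^ (1 + c - a) := by
    rw [← Complex.cpow_add _ _ htc]
    congr 1; ring
  simp only [Complex.real_smul, h1, powExp, abs_of_pos ha]
  rw [h2, Complex.ofReal_mul, Complex.ofReal_cpow ht.le]
  push_cast
  ring

/-- With `u = t ^ a` and `n ≥ p / a`, one has `u ^ (p / a) ≤ 1 + u ^ n ≤ (1 + n!) exp u`. -/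
theorem exists_rpow_mul_exp_neg_rpow_le {a p : ℝ} (ha : 0 < a) (hp : 0 ≤ p) :
    ∃ C : ℝ, 0 ≤ C ∧ ∀ t : ℝ, 0 < t → t ^ p * Real.exp (-t ^ a) ≤ C := by
  obtain ⟨n, hn⟩ := exists_nat_ge (p / a)
  refine ⟨1 + n.factorial, by positivity, fun t ht => ?_⟩
  set u := t ^ a with hu
  have hu0 : 0 < u := Real.rpow_pos_of_pos ht a
  have h1 : t ^ p = u ^ (p / a) := by
    rw [hu, ← Real.rpow_mul ht.le, mul_div_cancel₀ _ ha.ne']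
  have h2 : u ^ (p / a) ≤ 1 + u ^ n := by
    rcases le_total u 1 with h | h
    · exact (Real.rpow_le_one hu0.le h (by positivity)).trans (by simp [hu0.le])
    · have := Real.rpow_le_rpow_of_exponent_le h hn
      rw [Real.rpow_natCast] at this
      linarith
  have h3 : u ^ n ≤ n.factorial * Real.exp u := by
    have := Real.pow_div_factorial_le_exp u hu0.le n
    rwa [div_le_iff₀' (by positivity)] at this
  rw [h1, Real.exp_neg, ← div_eq_mul_inv, div_le_iff₀ (Real.exp_pos u)]
  nlinarith [Real.one_le_exp hu0.le]

theorem norm_powExpTerm {a : ℝ} {c : ℂ} {w : ℝ} (m : ℕ) :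
    ‖powExpTerm a c w m‖ = ((m : ℝ) + 1) ^ c.re * Real.exp (-w * ((m : ℝ) + 1) ^ a) := by
  have h : ((m : ℂ) + 1) = (((m : ℝ) + 1 : ℝ) : ℂ) := by push_cast; rfl
  rw [powExpTerm, norm_mul, h, Complex.norm_cpow_eq_rpow_re_of_pos (by positivity),
    Complex.norm_real, Real.norm_of_nonneg (Real.exp_pos _).le]

theorem summable_inv_nat_add_one_sq : Summable fun m : ℕ => (((m : ℝ) + 1) ^ 2)⁻¹ := by
  simpa using (summable_nat_add_iff 1).2 (Real.summable_nat_pow_inv.2 one_lt_two)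

theorem summable_powExpTerm {a : ℝ} (ha : 0 < a) (c : ℂ) {w : ℝ} (hw : 0 < w) :
    Summable (powExpTerm a c w) := by
  obtain ⟨C, hC, h⟩ := exists_rpow_mul_exp_neg_rpow_le ha (le_max_right (c.re + 2) 0)
  -- The extra exponent `2` leaves a summable `(m + 1) ^ (-2)`; the maximum with `0` allows every
  -- `c`.
  set p := max (c.re + 2) 0
  have hp : c.re + 2 ≤ p := le_max_left _ _
  set x := w ^ a⁻¹ with hx
  have hx0 : 0 < x := Real.rpow_pos_of_pos hw _
  have hxa : x ^ a = w := by rw [hx, ← Real.rpow_mul hw.le, inv_mul_cancel₀ ha.ne', Real.rpow_one]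
  refine Summable.of_norm_bounded (summable_inv_nat_add_one_sq.mul_left (C * x ^ (-p))) fun m => ?_
  have hm : (0 : ℝ) < (m : ℝ) + 1 := by positivity
  have h1 := h (x * (m + 1)) (by positivity)
  rw [Real.mul_rpow hx0.le hm.le, Real.mul_rpow hx0.le hm.le, hxa] at h1
  rw [norm_powExpTerm]
  rw [← neg_mul] at h1
  have h2 : ((m : ℝ) + 1) ^ c.re ≤ ((m : ℝ) + 1) ^ p * (((m : ℝ) + 1) ^ 2)⁻¹ := by
    rw [← Real.rpow_natCast _ 2, ← Real.rpow_neg hm.le, ← Real.rpow_add hm]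
    exact Real.rpow_le_rpow_of_exponent_le (by linarith [Nat.cast_nonneg (α := ℝ) m])
      (by push_cast; linarith)
  have hxp : x ^ (-p) * x ^ p = 1 := by rw [← Real.rpow_add hx0]; simp
  calc _ ≤ ((m : ℝ) + 1) ^ p * (((m : ℝ) + 1) ^ 2)⁻¹ * Real.exp (-w * ((m : ℝ) + 1) ^ a) := by
        gcongr
    _ = x ^ (-p) * (((m : ℝ) + 1) ^ 2)⁻¹ *
        (x ^ p * ((m : ℝ) + 1) ^ p * Real.exp (-w * ((m : ℝ) + 1) ^ a)) := by
        linear_combination (-((m : ℝ) + 1) ^ p * (((m : ℝ) + 1) ^ 2)⁻¹ *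
          Real.exp (-w * ((m : ℝ) + 1) ^ a)) * hxp
    _ ≤ x ^ (-p) * (((m : ℝ) + 1) ^ 2)⁻¹ * C := by gcongr
    _ = _ := by ring

/-- Termwise differentiation is legitimate on `(w/2, ∞)`, where the differentiated terms are
dominated by their values at `w/2`. -/
theorem hasDerivAt_powExpSeries {a : ℝ} (ha : 0 < a) (c : ℂ) {w : ℝ} (hw : 0 < w) :
    HasDerivAt (powExpSeries a c) (-powExpSeries a (c + a) w) w := by
  have hd : ∀ (m : ℕ) (y : ℝ), y ∈ Ioi (w / 2) →
      HasDerivAt (fun v => powExpTerm a c v m) (-powExpTerm a (c + a) y m) y := by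
    intro m y _
    have hm : (0 : ℝ) < (m : ℝ) + 1 := by positivity
    have h1 : HasDerivAt (fun v : ℝ => Real.exp (-v * ((m : ℝ) + 1) ^ a))
        (Real.exp (-y * ((m : ℝ) + 1) ^ a) * (-1 * ((m : ℝ) + 1) ^ a)) y :=
      (((hasDerivAt_id y).neg).mul_const _).exp
    refine (h1.ofReal_comp.const_mul (((m : ℂ) + 1) ^ c)).congr_deriv ?_
    rw [powExpTerm, Complex.cpow_add _ _ (Nat.cast_add_one_ne_zero m), Complex.ofReal_mul,
      Complex.ofReal_mul, Complex.ofReal_cpow hm.le]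
    push_cast
    ring
  have h := hasDerivAt_tsum_of_isPreconnected (y₀ := w)
    (summable_powExpTerm ha (c + a) (half_pos hw)).norm isOpen_Ioi isPreconnected_Ioi hd
    (fun m y hy => ?_) (half_lt_self hw) (summable_powExpTerm ha c hw) (half_lt_self hw)
  · rwa [tsum_neg] at h
  · rw [norm_neg, norm_powExpTerm, norm_powExpTerm]
    have : w / 2 ≤ y := le_of_lt hy
    gcongr

theorem iteratedDeriv_eq_of_hasDerivAt_succ {E : Type*} [NormedAddCommGroup E] [NormedSpace ℝ E]
    {s : Set ℝ} (hs : IsOpen s) {F : ℕ → ℝ → E}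
    (hF : ∀ k, ∀ x ∈ s, HasDerivAt (F k) (F (k + 1) x) x) {f : ℝ → E} (hf : EqOn f (F 0) s)
    (k : ℕ) : EqOn (iteratedDeriv k f) (F k) s := by
  induction k with
  | zero => simpa using hf
  | succ k ih =>
    intro x hx
    rw [iteratedDeriv_succ, (ih.eventuallyEq_of_mem (hs.mem_nhds hx)).deriv_eq]
    exact (hF k x hx).deriv

end PowerExponentialSums

/-! ### Behaviour of the Riemann sums at `0` and `∞`, and telescoping. -/

section RiemannSums

open Set Filter Topology MeasureTheory

theorem powExp_mul_nat_add_one {a : ℝ} (c : ℂ) {x : ℝ} (hx : 0 < x) (m : ℕ) :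
    powExp a c (x * ((m : ℝ) + 1)) = (x : ℂ) ^ c * powExpTerm a c (x ^ a) m := by
  have hm : (0 : ℝ) ≤ (m : ℝ) + 1 := by positivity
  rw [powExp, powExpTerm, Complex.ofReal_mul, Complex.mul_cpow_ofReal_nonneg hx.le hm,
    Real.mul_rpow hx.le hm, neg_mul]
  push_cast
  ring

/-- The Riemann sum with step `x` of `powExp a c` over the positive reals. -/
noncomputable def powExpRiemannSum (a : ℝ) (c : ℂ) (x : ℝ) : ℂ :=
  ∑' m : ℕ, (x : ℂ) * powExp a c (x * ((m : ℝ) + 1))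

theorem powExpRiemannSum_eq {a : ℝ} (c : ℂ) {x : ℝ} (hx : 0 < x) :
    powExpRiemannSum a c x = (x : ℂ) ^ (c + 1) * powExpSeries a c (x ^ a) := by
  rw [powExpRiemannSum, powExpSeries, ← tsum_mul_left]
  refine tsum_congr fun m => ?_
  rw [powExp_mul_nat_add_one c hx, Complex.cpow_add _ _ (by exact_mod_cast hx.ne'),
    Complex.cpow_one]
  ring

theorem summable_mul_powExp {a : ℝ} (ha : 0 < a) (c : ℂ) {x : ℝ} (hx : 0 < x) :
    Summable fun m : ℕ => (x : ℂ) * powExp a c (x * ((m : ℝ) + 1)) := by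
  simp_rw [powExp_mul_nat_add_one c hx]
  exact ((summable_powExpTerm ha c (Real.rpow_pos_of_pos hx a)).mul_left _).mul_left _

/-- Decay at infinity: `‖f(t)‖ ≤ C / t ^ 2`, summed over `t = x (m + 1)` with weight `x`. -/
theorem exists_norm_powExpRiemannSum_le {a : ℝ} (ha : 0 < a) {c : ℂ} (hc : -1 < c.re) :
    ∃ C : ℝ, ∀ x : ℝ, 0 < x → ‖powExpRiemannSum a c x‖ ≤ C * x⁻¹ := by
  obtain ⟨C, hC, h⟩ := exists_rpow_mul_exp_neg_rpow_le ha (p := c.re + 2) (by linarith)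
  refine ⟨C * ∑' m : ℕ, (((m : ℝ) + 1) ^ 2)⁻¹, fun x hx => ?_⟩
  have hs := summable_inv_nat_add_one_sq.mul_left (C * x⁻¹)
  have hb : ∀ m : ℕ, ‖(x : ℂ) * powExp a c (x * ((m : ℝ) + 1))‖ ≤
      C * x⁻¹ * (((m : ℝ) + 1) ^ 2)⁻¹ := by
    intro m
    have ht : 0 < x * ((m : ℝ) + 1) := by positivity
    have h1 := h _ ht
    rw [Real.rpow_add ht, Real.rpow_two, mul_right_comm, ← norm_powExp ht,
      ← le_div_iff₀ (by positivity)] at h1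
    rw [norm_mul, Complex.norm_real, Real.norm_of_nonneg hx.le]
    calc _ ≤ x * (C / (x * ((m : ℝ) + 1)) ^ 2) := by gcongr
      _ = _ := by field_simp
  refine (tsum_of_norm_bounded hs.hasSum hb).trans_eq ?_
  rw [tsum_mul_left]
  ring

/-- `powExp a c` may blow up at `0`; the factor `t` restores the continuity needed to integrate by
parts on the first cell. -/
theorem continuousOn_mul_powExp {a : ℝ} (ha : 0 < a) {c : ℂ} (hc : -1 < c.re) :
    ContinuousOn (fun t : ℝ => (t : ℂ) * powExp a c t) (Ici 0) := by
  have h : ContinuousOn (fun t : ℝ => (t : ℂ) ^ (c + 1) * (Real.exp (-t ^ a) : ℂ)) (Ici 0) := by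
    refine Continuous.continuousOn (Continuous.mul ?_ ?_)
    · exact Complex.continuous_ofReal_cpow_const (by simp; linarith)
    · exact Complex.continuous_ofReal.comp
        (Real.continuous_exp.comp (Real.continuous_rpow_const ha.le).neg)
  refine h.congr fun t ht => ?_
  have hc1 : c + 1 ≠ 0 := fun h0 => by
    have := congrArg Complex.re h0
    simp at this
    linarith
  rcases (mem_Ici.1 ht).eq_or_lt with rfl | ht
  · simp [hc1]
  · have htc : (t : ℂ) ≠ 0 := by exact_mod_cast ht.ne'
    simp only [powExp]
    rw [Complex.cpow_add _ _ htc, Complex.cpow_one]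
    ring

theorem continuousOn_powExpDeriv (a : ℝ) (c : ℂ) : ContinuousOn (powExpDeriv a c) (Ioi 0) :=
  ((continuousOn_powExp a _).const_smul c).sub ((continuousOn_powExp a _).const_smul (a : ℂ))

theorem integrableOn_rpow_mul_norm_powExpDeriv {a : ℝ} (ha : 0 < a) {c : ℂ} {r : ℝ}
    (hr : 0 < c.re + r) :
    IntegrableOn (fun t : ℝ => t ^ r * ‖powExpDeriv a c t‖) (Ioi 0) := by
  have h1 := (integrableOn_rpow_mul_exp_neg_rpow (s := c.re + r - 1) (by linarith) ha).const_mul ‖c‖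
  have h2 := (integrableOn_rpow_mul_exp_neg_rpow (s := c.re + r + a - 1) (by linarith) ha).const_mul a
  refine Integrable.mono' (h1.add h2) (ContinuousOn.aestronglyMeasurable ?_ measurableSet_Ioi) ?_
  · refine ContinuousOn.mul (fun t ht => ?_) (continuousOn_powExpDeriv a c).norm
    exact (Real.continuousAt_rpow_const _ _ (Or.inl (ne_of_gt ht))).continuousWithinAt
  · filter_upwards [ae_restrict_mem measurableSet_Ioi] with t ht
    have ht : 0 < t := ht
    rw [norm_mul, norm_norm, Real.norm_of_nonneg (Real.rpow_nonneg ht.le r)]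
    have h3 : ‖powExpDeriv a c t‖ ≤ ‖c‖ * (t ^ (c.re - 1) * Real.exp (-t ^ a)) +
        a * (t ^ (c.re + a - 1) * Real.exp (-t ^ a)) := by
      refine (norm_sub_le _ _).trans_eq ?_
      rw [norm_mul, norm_mul, norm_powExp ht, norm_powExp ht, Complex.norm_real,
        Real.norm_of_nonneg ha.le]
      simp
    refine (mul_le_mul_of_nonneg_left h3 (Real.rpow_nonneg ht.le r)).trans_eq ?_
    simp only [Pi.add_apply]
    rw [show c.re + r - 1 = r + (c.re - 1) by ring,
      show c.re + r + a - 1 = r + (c.re + a - 1) by ring, Real.rpow_add ht, Real.rpow_add ht]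
    ring

/-- On a cell `(l, u]` of length `x`, integration by parts gives `x f(u) - ∫ f = ∫ (t - l) f'(t)`.
Bounding `t - l` by `x ^ ε t ^ (1 - ε)` extracts a power of `x` and keeps enough of `t` to tame `f'`
at `0`. -/
theorem norm_mul_powExp_sub_integral_le {a : ℝ} (ha : 0 < a) {c : ℂ} (hc : -1 < c.re) {ε : ℝ}
    (hε : 0 < ε) (hε1 : ε ≤ 1) (hεc : ε < c.re + 1) {x : ℝ} (hx : 0 < x) (m : ℕ) :
    ‖(x : ℂ) * powExp a c (x * ((m : ℝ) + 1)) -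
        ∫ t in Ioc (x * (m : ℝ)) (x * ((m : ℝ) + 1)), powExp a c t‖ ≤
      x ^ ε * ∫ t in Ioc (x * (m : ℝ)) (x * ((m : ℝ) + 1)), t ^ (1 - ε) * ‖powExpDeriv a c t‖ := by
  set l := x * (m : ℝ) with hl
  set u := x * ((m : ℝ) + 1) with hu
  have hl0 : 0 ≤ l := by positivity
  have hul : u = l + x := by rw [hu, hl]; ring
  have hlu : l ≤ u := by linarith
  have hsub : Ioc l u ⊆ Ioi 0 := fun t ht => hl0.trans_lt ht.1
  have hg : IntegrableOn (powExp a c) (Ioc l u) := (integrableOn_powExp ha hc).mono_set hsub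
  have hW : IntegrableOn (fun t : ℝ => t ^ (1 - ε) * ‖powExpDeriv a c t‖) (Ioc l u) :=
    (integrableOn_rpow_mul_norm_powExpDeriv ha (by linarith)).mono_set hsub
  have hle : ∀ t ∈ Ioc l u, ‖((t - l : ℝ) : ℂ) * powExpDeriv a c t‖ ≤
      x ^ ε * (t ^ (1 - ε) * ‖powExpDeriv a c t‖) := by
    intro t ht
    have ht0 : 0 < t := hsub ht
    have htl : 0 < t - l := sub_pos.2 ht.1
    rw [norm_mul, Complex.norm_real, Real.norm_of_nonneg htl.le, ← mul_assoc]
    gcongr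
    calc t - l = (t - l) ^ ε * (t - l) ^ (1 - ε) := by rw [← Real.rpow_add htl]; simp
      _ ≤ x ^ ε * t ^ (1 - ε) := by
        have h1 : t - l ≤ x := by linarith [ht.2]
        have h2 : t - l ≤ t := by linarith
        have h3 : 0 ≤ 1 - ε := by linarith
        gcongr
  have hD : IntegrableOn (fun t : ℝ => ((t - l : ℝ) : ℂ) * powExpDeriv a c t) (Ioc l u) := by
    refine Integrable.mono' (hW.const_mul (x ^ ε)) (ContinuousOn.aestronglyMeasurable ?_
      measurableSet_Ioc) ?_
    · exact ContinuousOn.mul (by fun_prop) ((continuousOn_powExpDeriv a c).mono hsub)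
    · filter_upwards [ae_restrict_mem measurableSet_Ioc] with t ht using hle t ht
  have hcont : ContinuousOn (fun t : ℝ => ((t - l : ℝ) : ℂ) * powExp a c t) (Icc l u) := by
    rcases hl0.eq_or_lt with h0 | h0
    · rw [← h0]
      simp only [sub_zero]
      exact (continuousOn_mul_powExp ha hc).mono Icc_subset_Ici_self
    · exact ContinuousOn.mul (by fun_prop)
        ((continuousOn_powExp a c).mono fun t ht => h0.trans_le ht.1)
  have hsum : ∫ t in Ioc l u, (powExp a c t + ((t - l : ℝ) : ℂ) * powExpDeriv a c t) =
      (x : ℂ) * powExp a c u := by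
    have := intervalIntegral.integral_eq_sub_of_hasDerivAt_of_le hlu hcont
      (f' := fun t => powExp a c t + ((t - l : ℝ) : ℂ) * powExpDeriv a c t) (fun t ht => ?_)
      ((intervalIntegrable_iff_integrableOn_Ioc_of_le hlu).2 (hg.add hD))
    · rw [intervalIntegral.integral_of_le hlu] at this
      rw [this, hul]
      simp
    · have h1 := (((hasDerivAt_id t).sub_const l).ofReal_comp).mul
        (hasDerivAt_powExp (a := a) (c := c) (hl0.trans_lt ht.1))
      exact h1.congr_deriv (by simp)
  rw [← hsum, integral_add hg hD, add_sub_cancel_left, ← integral_const_mul]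
  refine norm_integral_le_of_norm_le (hW.const_mul _) ?_
  filter_upwards [ae_restrict_mem measurableSet_Ioc] with t ht using hle t ht

theorem hasSum_integral_Ioc_mul_nat {E : Type*} [NormedAddCommGroup E] [NormedSpace ℝ E]
    {f : ℝ → E} (hf : IntegrableOn f (Ioi 0)) {x : ℝ} (hx : 0 < x) :
    HasSum (fun m : ℕ => ∫ t in Ioc (x * (m : ℝ)) (x * ((m : ℝ) + 1)), f t)
      (∫ t in Ioi 0, f t) := by
  have hmono : Monotone fun m : ℕ => x * (m : ℝ) := fun i j hij => by
    have : (i : ℝ) ≤ j := by exact_mod_cast hij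
    exact mul_le_mul_of_nonneg_left this hx.le
  have hU : ⋃ m : ℕ, Ioc (x * (m : ℝ)) (x * ((m : ℝ) + 1)) = Ioi 0 := by
    have hnb : ¬ BddAbove (range fun m : ℕ => x * (m : ℝ)) := by
      rintro ⟨B, hB⟩
      obtain ⟨n, hn⟩ := exists_nat_gt (B / x)
      have := hB (mem_range_self n)
      rw [div_lt_iff₀' hx] at hn
      linarith
    simpa using iUnion_Ioc_map_succ_eq_Ioi (f := fun m : ℕ => x * (m : ℝ))
      (fun i => hmono (Nat.zero_le i)) hnb
  have hdis := hmono.pairwise_disjoint_on_Ioc_succ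
  have := hasSum_integral_iUnion (μ := volume) (f := f)
    (s := fun m : ℕ => Ioc (x * (m : ℝ)) (x * ((m : ℝ) + 1))) (fun _ => measurableSet_Ioc)
    (by simpa using hdis) (by rwa [hU])
  rwa [hU] at this

theorem exists_norm_powExpRiemannSum_sub_integral_le {a : ℝ} (ha : 0 < a) {c : ℂ}
    (hc : -1 < c.re) : ∃ C ε : ℝ, 0 < ε ∧ ∀ x : ℝ, 0 < x →
      ‖powExpRiemannSum a c x - ∫ t in Ioi 0, powExp a c t‖ ≤ C * x ^ ε := by
  -- `ε < c.re + 1` makes `t ^ (1 - ε) ‖f'(t)‖` integrable at `0`.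
  set ε := min 1 ((c.re + 1) / 2)
  have hε : 0 < ε := lt_min one_pos (by linarith)
  have hε1 : ε ≤ 1 := min_le_left _ _
  have hεc : ε < c.re + 1 := (min_le_right _ _).trans_lt (by linarith)
  have hW := integrableOn_rpow_mul_norm_powExpDeriv ha (c := c) (r := 1 - ε) (by linarith)
  refine ⟨∫ t in Ioi 0, t ^ (1 - ε) * ‖powExpDeriv a c t‖, ε, hε, fun x hx => ?_⟩
  have h1 := (summable_mul_powExp ha c hx).hasSum.sub
    (hasSum_integral_Ioc_mul_nat (integrableOn_powExp ha hc) hx)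
  have h2 := (hasSum_integral_Ioc_mul_nat hW hx).mul_left (x ^ ε)
  rw [powExpRiemannSum, ← h1.tsum_eq, mul_comm]
  exact tsum_of_norm_bounded h2
    (norm_mul_powExp_sub_integral_le ha hc hε hε1 hεc hx)

/-- Subtracting the shifted series gives `0`; the differences of the step function `A · [n < 0]`
contribute `A`, at `n = -1` only. -/
theorem hasSum_sub_succ_of_summable {E : Type*} [NormedAddCommGroup E] {T : ℤ → E} {A : E}
    (h : Summable fun n : ℤ => T n - if n < 0 then A else 0) :
    HasSum (fun n : ℤ => T n - T (n + 1)) A := by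
  have h1 := h.hasSum
  have h2 := ((Equiv.addRight (1 : ℤ)).hasSum_iff).2 h1
  have h3 := (h1.sub h2).add (hasSum_ite_eq (-1 : ℤ) A)
  rw [sub_self, zero_add] at h3
  refine h3.congr_fun fun n => ?_
  simp only [Function.comp_apply, Equiv.coe_addRight]
  rcases lt_trichotomy n (-1) with hn | rfl | hn
  · rw [if_pos (by omega), if_pos (by omega), if_neg (by omega)]; abel
  · simp only [Int.reduceNeg, Int.reduceLT, Int.reduceAdd, if_true, if_false]; abel
  · rw [if_neg (by omega), if_neg (by omega), if_neg (by omega)]; abel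

theorem hasSum_sub_succ_geometric {E : Type*} [NormedAddCommGroup E] [CompleteSpace E]
    {L : ℝ → E} {A : E} {C₀ C₁ ε q y : ℝ} (hε : 0 < ε)
    (h0 : ∀ x : ℝ, 0 < x → ‖L x - A‖ ≤ C₀ * x ^ ε) (h1 : ∀ x : ℝ, 0 < x → ‖L x‖ ≤ C₁ * x⁻¹)
    (hq : 1 < q) (hy : 0 < y) :
    HasSum (fun n : ℤ => L (y * q ^ n) - L (y * q ^ (n + 1))) A := by
  have hq0 : 0 < q := one_pos.trans hq
  refine hasSum_sub_succ_of_summable (T := fun n : ℤ => L (y * q ^ n)) (.of_nat_of_neg_add_one ?_ ?_)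
  · refine Summable.of_norm_bounded ((summable_geometric_of_lt_one (inv_nonneg.2 hq0.le)
      (inv_lt_one_of_one_lt₀ hq)).mul_left (C₁ * y⁻¹)) fun n => ?_
    rw [if_neg (by omega), sub_zero]
    refine (h1 _ (by positivity)).trans_eq ?_
    rw [mul_inv, zpow_natCast, inv_pow, mul_assoc]
  · have hr : (q ^ ε)⁻¹ < 1 := inv_lt_one_of_one_lt₀ (Real.one_lt_rpow hq hε)
    refine Summable.of_norm_bounded ((summable_geometric_of_lt_one (by positivity)
      hr).mul_left (C₀ * y ^ ε * (q ^ ε)⁻¹)) fun n => ?_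
    rw [if_pos (by omega)]
    refine (h0 _ (by positivity)).trans_eq ?_
    rw [Real.mul_rpow hy.le (by positivity), mul_assoc, mul_assoc]
    congr 2
    rw [zpow_neg, Real.inv_rpow (by positivity), ← pow_succ', inv_pow]
    congr 1
    norm_cast
    rw [← Real.rpow_natCast, ← Real.rpow_natCast, ← Real.rpow_mul hq0.le, ← Real.rpow_mul hq0.le,
      mul_comm]

end RiemannSums

/-! ### Reduction of `Phi` to Riemann sums, and the two identities. -/

section Multisection

open Set Filter Topology MeasureTheory

theorem HasSum.sum_range_mul_add {E : Type*} [NormedAddCommGroup E] {T : ℕ → E} {s : E}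
    (h : HasSum T s) (K : ℕ) [NeZero K] :
    HasSum (fun n : ℕ => ∑ j ∈ Finset.range K, T (n * K + j)) s := by
  have h1 := ((Nat.divModEquiv K).symm.hasSum_iff).2 h
  have h2 := h1.prod_fiberwise fun n => hasSum_fintype _
  refine h2.congr_fun fun n => ?_
  rw [← Fin.sum_univ_eq_sum_range (fun j => T (n * K + j)) K]
  rfl

theorem natCast_mul_powExpTerm (a : ℝ) (b : ℂ) {K : ℕ} (hK : 0 < K) (w : ℝ) (n : ℕ) :
    (K : ℂ) * (((K : ℂ) * ((n : ℂ) + 1)) ^ b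
      * (Real.exp (-w * ((K : ℝ) * ((n : ℝ) + 1)) ^ a) : ℂ)) =
    (K : ℂ) ^ (1 + b) * powExpTerm a b ((K : ℝ) ^ a * w) n := by
  have hK0 : (K : ℂ) ≠ 0 := by exact_mod_cast hK.ne'
  have h1 : ((K : ℂ) * ((n : ℂ) + 1)) ^ b = (K : ℂ) ^ b * ((n : ℂ) + 1) ^ b := by
    have := Complex.mul_cpow_ofReal_nonneg (a := (K : ℝ)) (b := (n : ℝ) + 1) (by positivity)
      (by positivity) b
    push_cast at this
    exact this
  rw [h1, powExpTerm, Complex.cpow_add _ _ hK0, Complex.cpow_one,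
    Real.mul_rpow (by positivity) (by positivity),
    show -w * ((K : ℝ) ^ a * ((n : ℝ) + 1) ^ a) = -((K : ℝ) ^ a * w) * ((n : ℝ) + 1) ^ a by ring]
  ring

theorem powExpTerm_mul_add (a : ℝ) (b : ℂ) (w : ℝ) {K k n m : ℕ} (h : m + 1 + k = K * (n + 1)) :
    powExpTerm a b w m = ((K : ℂ) * ((n : ℂ) + 1) - (k : ℂ)) ^ b
        * (Real.exp (-w * ((K : ℝ) * ((n : ℝ) + 1) - (k : ℝ)) ^ a) : ℂ) := by
  have h1 : (K : ℝ) * ((n : ℝ) + 1) - (k : ℝ) = (m : ℝ) + 1 := by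
    rw [sub_eq_iff_eq_add]; exact_mod_cast h.symm
  have h2 : (K : ℂ) * ((n : ℂ) + 1) - (k : ℂ) = (m : ℂ) + 1 := by exact_mod_cast congrArg Complex.ofReal h1
  rw [h1, h2, powExpTerm]

/-- The `K - 1` subtracted copies of the term at `K n` become `K` copies once the missing index `k =
0` is added; the first parts then run over all positive integers, block by block. -/
theorem phiSeries_eq {a : ℝ} (ha : 0 < a) (b : ℂ) {K : ℕ} (hK : 0 < K) {w : ℝ} (hw : 0 < w) :
    phiSeries a b K w =
      powExpSeries a b w - (K : ℂ) ^ (1 + b) * powExpSeries a b ((K : ℝ) ^ a * w) := by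
  have : NeZero K := ⟨hK.ne'⟩
  have h1 := (summable_powExpTerm ha b hw).hasSum.sum_range_mul_add K
  have hw' : 0 < (K : ℝ) ^ a * w := by positivity
  have h2 := (summable_powExpTerm ha b hw').hasSum.mul_left ((K : ℂ) ^ (1 + b))
  refine (HasSum.congr_fun (h1.sub h2) fun n => ?_).tsum_eq
  rw [← natCast_mul_powExpTerm a b hK, ← Finset.sum_range_reflect]
  obtain ⟨K, rfl⟩ := Nat.exists_eq_succ_of_ne_zero hK.ne'
  rw [Finset.sum_sub_distrib, Finset.sum_const, Finset.sum_range_succ', Nat.card_Icc,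
    Finset.range_eq_Ico, Finset.sum_Ico_add' (fun k => powExpTerm a b w (n * (K + 1) +
      (K + 1 - 1 - k))) 0 K 1, zero_add]
  have h3 : ∑ k ∈ Finset.Ico 1 (K + 1), powExpTerm a b w (n * (K + 1) + (K + 1 - 1 - k)) =
      ∑ k ∈ Finset.Icc 1 (K + 1 - 1), ((((K + 1 : ℕ) : ℂ) * ((n : ℂ) + 1) - (k : ℂ)) ^ b
        * (Real.exp (-w * (((K + 1 : ℕ) : ℝ) * ((n : ℝ) + 1) - (k : ℝ)) ^ a) : ℂ)) := by
    refine Finset.sum_congr (by ext; simp) fun k hk => powExpTerm_mul_add a b w ?_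
    have hk := (Finset.mem_Ico.1 hk).2
    have : K + 1 - 1 - k + 1 + k = K + 1 := by omega
    linear_combination this
  have h4 : powExpTerm a b w (n * (K + 1) + (K + 1 - 1 - 0)) = _ :=
    powExpTerm_mul_add a b w (K := K + 1) (k := 0) (n := n) (by simp; ring)
  simp only [Nat.succ_eq_add_one] at *
  rw [h3, h4]
  simp only [nsmul_eq_mul, Nat.cast_zero, sub_zero, Nat.add_sub_cancel]
  push_cast
  ring

/-- The derivatives of `phiSeries a b K` at positive reals. -/
noncomputable def phiSeriesDeriv (a : ℝ) (b : ℂ) (K k : ℕ) (w : ℝ) : ℂ :=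
  (-1) ^ k * (powExpSeries a (b + k * a) w -
    (K : ℂ) ^ (1 + (b + k * a)) * powExpSeries a (b + k * a) ((K : ℝ) ^ a * w))

theorem hasDerivAt_phiSeriesDeriv {a : ℝ} (ha : 0 < a) (b : ℂ) {K : ℕ} (hK : 0 < K) (k : ℕ)
    {w : ℝ} (hw : 0 < w) :
    HasDerivAt (phiSeriesDeriv a b K k) (phiSeriesDeriv a b K (k + 1) w) w := by
  have hK0 : (K : ℂ) ≠ 0 := by exact_mod_cast hK.ne'
  have h1 := hasDerivAt_powExpSeries ha (b + k * a) hw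
  have hw' : 0 < (K : ℝ) ^ a * w := by positivity
  have h2 := (hasDerivAt_powExpSeries ha (b + k * a) hw').scomp w
    ((hasDerivAt_id w).const_mul ((K : ℝ) ^ a))
  have h3 := (h1.sub (h2.const_mul ((K : ℂ) ^ (1 + (b + k * a))))).const_mul ((-1) ^ k)
  refine h3.congr_deriv ?_
  have h4 : b + ((k + 1 : ℕ) : ℂ) * a = b + k * a + a := by push_cast; ring
  rw [phiSeriesDeriv, h4, ← add_assoc 1 (b + k * a), Complex.cpow_add _ (a : ℂ) hK0, Complex.real_smul,
    Complex.ofReal_mul, Complex.ofReal_cpow (Nat.cast_nonneg K)]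
  simp only [Complex.ofReal_natCast, Complex.ofReal_one]
  ring

theorem Phi_eq {a : ℝ} (ha : 0 < a) (b : ℂ) {K : ℕ} (hK : 0 < K) (J : ℕ) {w : ℝ} (hw : 0 < w) :
    Phi a b K J w = (-1) ^ J * phiSeriesDeriv a b K J w := by
  rw [Phi, iteratedDeriv_eq_of_hasDerivAt_succ isOpen_Ioi
    (fun k x hx => hasDerivAt_phiSeriesDeriv ha b hK k hx) (fun x hx => ?_) J hw]
  rw [phiSeries_eq ha b hK hx, phiSeriesDeriv]
  simp

theorem Phi_eq_sub {a : ℝ} (ha : 0 < a) (b : ℂ) {K : ℕ} (hK : 0 < K) (J : ℕ) {w : ℝ}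
    (hw : 0 < w) :
    Phi a b K J w = powExpSeries a (b + J * a) w -
      (K : ℂ) ^ (1 + (b + J * a)) * powExpSeries a (b + J * a) ((K : ℝ) ^ a * w) := by
  rw [Phi_eq ha b hK J hw, phiSeriesDeriv, ← mul_assoc, ← pow_add, Even.neg_one_pow ⟨J, rfl⟩,
    one_mul]

theorem cpow_mul_Phi_sub_Phi {a : ℝ} (ha : 0 < a) (b : ℂ) {M N : ℕ} (hM : 0 < M) (hN : 0 < N)
    (J : ℕ) {v : ℝ} (hv : 0 < v) :
    (v : ℂ) ^ (b + J * a + 1) * (Phi a b M J (v ^ a) - Phi a b N J (v ^ a)) =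
      powExpRiemannSum a (b + J * a) (N * v) - powExpRiemannSum a (b + J * a) (M * v) := by
  have hva := Real.rpow_pos_of_pos hv a
  have h : ∀ K : ℕ, 0 < K → powExpRiemannSum a (b + J * a) (K * v) =
      (v : ℂ) ^ (b + J * a + 1) * ((K : ℂ) ^ (1 + (b + J * a)) *
        powExpSeries a (b + J * a) ((K : ℝ) ^ a * v ^ a)) := by
    intro K hK
    rw [powExpRiemannSum_eq _ (by positivity), Real.mul_rpow (Nat.cast_nonneg K) hv.le,
      Complex.ofReal_mul, Complex.mul_cpow_ofReal_nonneg (Nat.cast_nonneg K) hv.le,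
      Complex.ofReal_natCast, add_comm 1]
    ring
  rw [h N hN, h M hM, Phi_eq_sub ha b hM J hva, Phi_eq_sub ha b hN J hva]
  ring

theorem hasSum_powExpRiemannSum_sub_succ {a : ℝ} (ha : 0 < a) {c : ℂ} (hc : -1 < c.re)
    {q y : ℝ} (hq : 1 < q) (hy : 0 < y) :
    HasSum (fun n : ℤ => powExpRiemannSum a c (y * q ^ n) - powExpRiemannSum a c (y * q ^ (n + 1)))
      (Complex.Gamma ((1 + c) / a) / a) := by
  obtain ⟨C₀, ε, hε, h0⟩ := exists_norm_powExpRiemannSum_sub_integral_le ha hc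
  obtain ⟨C₁, h1⟩ := exists_norm_powExpRiemannSum_le ha hc
  rw [integral_powExp ha hc] at h0
  exact hasSum_sub_succ_geometric hε h0 h1 hq hy

/-- Reversing `n` replaces `q` by `q⁻¹ > 1` and swaps the two terms of each difference, hence the
sign. -/
theorem hasSum_powExpRiemannSum_sub_succ_of_lt_one {a : ℝ} (ha : 0 < a) {c : ℂ} (hc : -1 < c.re)
    {q y : ℝ} (hq0 : 0 < q) (hq : q < 1) (hy : 0 < y) :
    HasSum (fun n : ℤ => powExpRiemannSum a c (y * q ^ n) - powExpRiemannSum a c (y * q ^ (n + 1)))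
      (-(Complex.Gamma ((1 + c) / a) / a)) := by
  have h := (hasSum_powExpRiemannSum_sub_succ ha hc ((one_lt_inv₀ hq0).2 hq)
    (mul_pos hy hq0)).neg
  refine (((Equiv.neg ℤ).hasSum_iff).2 h).congr_fun fun n => ?_
  simp only [Function.comp_apply, Equiv.neg_apply, neg_sub]
  have h1 : y * q * q⁻¹ ^ (-n) = y * q ^ (n + 1) := by
    rw [inv_zpow', neg_neg, zpow_add_one₀ hq0.ne']; ring
  have h2 : y * q * q⁻¹ ^ (-n + 1) = y * q ^ n := by
    rw [inv_zpow', mul_assoc, ← zpow_one_add₀ hq0.ne']; congr 2; ring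
  rw [h1, h2]

theorem hasSum_cpow_mul_Phi_sub_Phi {M N : ℕ} (J : ℕ) {a : ℝ} {b : ℂ} (z : ℝ) (hM : 0 < M)
    (hN : 0 < N) (hMN : M ≠ N) (ha : 0 < a) (hb : -(J : ℝ) * a - 1 < b.re) :
    HasSum
      (fun n : ℤ =>
        (((M : ℂ) / (N : ℂ)) ^ (((a : ℂ) * (J : ℂ) + 1 + b) * ((n : ℂ) + (z : ℂ))))
          * (Phi a b M J (((M : ℝ) / (N : ℝ)) ^ (a * (z + (n : ℝ))))
            - Phi a b N J (((M : ℝ) / (N : ℝ)) ^ (a * (z + (n : ℝ))))))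
      ((Real.sign ((M : ℝ) - (N : ℝ)) : ℂ)
        * (Complex.Gamma ((1 + b) / (a : ℂ) + (J : ℂ)) / (a : ℂ))) := by
  have hM' : (0 : ℝ) < M := by exact_mod_cast hM
  have hN' : (0 : ℝ) < N := by exact_mod_cast hN
  have hac : (a : ℂ) ≠ 0 := by exact_mod_cast ha.ne'
  set q : ℝ := (M : ℝ) / N with hq
  have hq0 : 0 < q := div_pos hM' hN'
  have hc : -1 < (b + J * a).re := by
    have : ((J : ℂ) * a).re = J * a := by
      rw [← Complex.ofReal_natCast, ← Complex.ofReal_mul, Complex.ofReal_re]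
    rw [Complex.add_re, this]
    linarith
  have hG : (1 + b) / (a : ℂ) + J = (1 + (b + J * a)) / a := by field_simp; ring
  have hy : 0 < N * q ^ z := mul_pos hN' (Real.rpow_pos_of_pos hq0 z)
  have key : HasSum (fun n : ℤ => powExpRiemannSum a (b + J * a) (N * q ^ z * q ^ n) -
      powExpRiemannSum a (b + J * a) (N * q ^ z * q ^ (n + 1)))
      ((Real.sign ((M : ℝ) - (N : ℝ)) : ℂ) * (Complex.Gamma ((1 + b) / a + J) / a)) := by
    rw [hG]
    rcases hMN.lt_or_gt with h | h
    · have h' : (M : ℝ) < N := by exact_mod_cast h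
      rw [Real.sign_of_neg (sub_neg.2 h')]
      simpa using hasSum_powExpRiemannSum_sub_succ_of_lt_one ha hc hq0 ((div_lt_one hN').2 h') hy
    · have h' : (N : ℝ) < M := by exact_mod_cast h
      rw [Real.sign_of_pos (sub_pos.2 h')]
      simpa using hasSum_powExpRiemannSum_sub_succ ha hc ((one_lt_div hN').2 h') hy
  refine key.congr_fun fun n => ?_
  have hv : 0 < q ^ (z + (n : ℝ)) := Real.rpow_pos_of_pos hq0 _
  have h1 : q ^ (a * (z + (n : ℝ))) = (q ^ (z + (n : ℝ))) ^ a := by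
    rw [← Real.rpow_mul hq0.le, mul_comm]
  have h2 : ((M : ℂ) / (N : ℂ)) ^ (((a : ℂ) * (J : ℂ) + 1 + b) * ((n : ℂ) + (z : ℂ))) =
      ((q ^ (z + (n : ℝ)) : ℝ) : ℂ) ^ (b + J * a + 1) := by
    have hqc : (q : ℂ) ≠ 0 := by exact_mod_cast hq0.ne'
    have hvc : ((q ^ (z + (n : ℝ)) : ℝ) : ℂ) ≠ 0 := by exact_mod_cast hv.ne'
    rw [show (M : ℂ) / (N : ℂ) = (q : ℂ) by rw [hq]; push_cast; rfl,
      Complex.cpow_def_of_ne_zero hqc, Complex.cpow_def_of_ne_zero hvc,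
      ← Complex.ofReal_log hq0.le, ← Complex.ofReal_log hv.le, Real.log_rpow hq0]
    congr 1
    push_cast
    ring
  have h3 : (N : ℝ) * q ^ z * q ^ n = N * q ^ (z + (n : ℝ)) := by
    rw [Real.rpow_add hq0, Real.rpow_intCast, mul_assoc]
  -- Since `N q = M`, the argument `M v` is the next point of the progression after `N v`.
  have h4 : (N : ℝ) * q ^ z * q ^ (n + 1) = M * q ^ (z + (n : ℝ)) := by
    rw [zpow_add_one₀ hq0.ne', ← mul_assoc, h3, hq]
    field_simp
  rw [h1, h2, h3, h4, cpow_mul_Phi_sub_Phi ha b hM hN J hv]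

theorem powExpSeries_one_zero {t : ℝ} (ht : 0 < t) :
    powExpSeries 1 0 t = ((1 / (Real.exp t - 1) : ℝ) : ℂ) := by
  have h1 : Real.exp (-t) < 1 := by simpa using ht
  have h2 := (hasSum_geometric_of_lt_one (Real.exp_pos (-t)).le h1).mul_left (Real.exp (-t))
  have h3 : Real.exp (-t) * (1 - Real.exp (-t))⁻¹ = 1 / (Real.exp t - 1) := by
    have : Real.exp t - 1 ≠ 0 := (sub_pos.2 (Real.one_lt_exp_iff.2 ht)).ne'
    have h4 : (1 - Real.exp (-t)) = (Real.exp t - 1) * Real.exp (-t) := by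
      rw [sub_mul, ← Real.exp_add]; simp
    rw [h4]
    field_simp
  rw [h3] at h2
  refine (Complex.hasSum_ofReal.2 h2).congr_fun (fun m => ?_) |>.tsum_eq
  rw [powExpTerm, Complex.cpow_zero, one_mul, Real.rpow_one, ← Real.exp_nat_mul, ← Real.exp_add]
  norm_cast
  congr 1
  push_cast
  ring

/-- For `a = 1`, `b = 0` the series is geometric, and before differentiation `Φ_K(t) = S(t) - K /
(exp (K t) - 1)`; the common `S` cancels in `Φ_M - Φ_N`. -/
theorem phiExp_eq_re (J : ℕ) {M N : ℕ} (hM : 0 < M) (hN : 0 < N) {t : ℝ} (ht : 0 < t) :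
    phiExp J M N t = (Phi 1 0 M J t - Phi 1 0 N J t).re := by
  have hd : ∀ (k : ℕ) (x : ℝ), x ∈ Ioi (0 : ℝ) →
      HasDerivAt (fun x => (phiSeriesDeriv 1 0 M k x - phiSeriesDeriv 1 0 N k x).re)
        ((phiSeriesDeriv 1 0 M (k + 1) x - phiSeriesDeriv 1 0 N (k + 1) x).re) x := by
    intro k x hx
    exact Complex.reCLM.hasFDerivAt.comp_hasDerivAt x
      ((hasDerivAt_phiSeriesDeriv one_pos 0 hM k hx).sub
        (hasDerivAt_phiSeriesDeriv one_pos 0 hN k hx))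
  rw [phiExp, iteratedDeriv_eq_of_hasDerivAt_succ isOpen_Ioi
    (F := fun k x => (phiSeriesDeriv 1 0 M k x - phiSeriesDeriv 1 0 N k x).re) hd
    (fun x hx => ?_) J ht, Phi_eq one_pos 0 hM J ht, Phi_eq one_pos 0 hN J ht, ← mul_sub]
  · rw [show ((-1 : ℂ)) ^ J = (((-1 : ℝ) ^ J : ℝ) : ℂ) by push_cast; rfl, Complex.re_ofReal_mul]
  · have hx : 0 < x := hx
    have h : ∀ K : ℕ, 0 < K → phiSeriesDeriv 1 0 K 0 x =
        powExpSeries 1 0 x - ((K / (Real.exp (K * x) - 1) : ℝ) : ℂ) := by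
      intro K hK
      simp only [phiSeriesDeriv, pow_zero, one_mul, Nat.cast_zero, zero_mul, add_zero,
        Complex.cpow_one, Real.rpow_one]
      rw [powExpSeries_one_zero (t := K * x) (by positivity)]
      push_cast
      ring
    simp only [h M hM, h N hN, sub_sub_sub_cancel_left]
    rw [← Complex.ofReal_sub, Complex.ofReal_re]

theorem hasSum_rpow_mul_phiExp {M N : ℕ} (J : ℕ) (w : ℝ) (hN : 0 < N) (hMN : N < M) :
    HasSum
      (fun n : ℤ =>
        (((M : ℝ) / (N : ℝ)) ^ (((J : ℝ) + 1) * ((n : ℝ) + w)))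
          * phiExp J M N (((M : ℝ) / (N : ℝ)) ^ ((n : ℝ) + w)))
      (J.factorial : ℝ) := by
  have hM : 0 < M := hN.trans hMN
  have hM' : (0 : ℝ) < M := by exact_mod_cast hM
  have hN' : (0 : ℝ) < N := by exact_mod_cast hN
  have h := hasSum_cpow_mul_Phi_sub_Phi J (a := 1) (b := 0) w hM hN hMN.ne' one_pos (by
    simp only [mul_one, Complex.zero_re]
    linarith [Nat.cast_nonneg (α := ℝ) J])
  have h' : (0 : ℝ) < M - N := sub_pos.2 (by exact_mod_cast hMN)
  have hG : ((Real.sign ((M : ℝ) - N) : ℝ) : ℂ) *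
      (Complex.Gamma ((1 + 0) / ((1 : ℝ) : ℂ) + (J : ℂ)) / ((1 : ℝ) : ℂ)) = J.factorial := by
    rw [Real.sign_of_pos h', Complex.ofReal_one, add_zero, div_one, div_one, one_mul, add_comm 1,
      Complex.Gamma_nat_eq_factorial]
  rw [hG] at h
  have h2 := Complex.hasSum_re h
  rw [Complex.natCast_re] at h2
  refine h2.congr_fun fun n => ?_
  have hq0 : 0 < (M : ℝ) / N := div_pos hM' hN'
  have h3 : ((M : ℂ) / (N : ℂ)) ^ ((((1 : ℝ) : ℂ) * (J : ℂ) + 1 + 0) * ((n : ℂ) + (w : ℂ))) =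
      ((((M : ℝ) / (N : ℝ)) ^ (((J : ℝ) + 1) * ((n : ℝ) + w)) : ℝ) : ℂ) := by
    rw [Complex.ofReal_cpow hq0.le]
    push_cast
    congr 1
    ring
  rw [h3, Complex.re_ofReal_mul, one_mul, add_comm w, phiExp_eq_re J hM hN (by positivity)]

end Multisection

theorem mainTheorem4 :
    (∀ (M N J : ℕ) (a : ℝ) (b : ℂ) (z : ℝ),
      1 < M → 1 < N → M ≠ N → 0 < a → -(J : ℝ) * a - 1 < b.re →
      HasSum
        (fun n : ℤ =>
          (((M : ℂ) / (N : ℂ)) ^ (((a : ℂ) * (J : ℂ) + 1 + b) * ((n : ℂ) + (z : ℂ))))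
            * (Phi a b M J (((M : ℝ) / (N : ℝ)) ^ (a * (z + (n : ℝ))))
              - Phi a b N J (((M : ℝ) / (N : ℝ)) ^ (a * (z + (n : ℝ))))))
        ((Real.sign ((M : ℝ) - (N : ℝ)) : ℂ)
          * (Complex.Gamma ((1 + b) / (a : ℂ) + (J : ℂ)) / (a : ℂ)))) ∧
    (∀ (M N J : ℕ) (w : ℝ), 1 < N → N < M →
      HasSum
        (fun n : ℤ =>
          (((M : ℝ) / (N : ℝ)) ^ (((J : ℝ) + 1) * ((n : ℝ) + w)))
            * phiExp J M N (((M : ℝ) / (N : ℝ)) ^ ((n : ℝ) + w)))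
        (J.factorial : ℝ)) := by
  exact ⟨fun M N J _ _ z hM hN hMN ha hb =>
      hasSum_cpow_mul_Phi_sub_Phi J z (one_pos.trans hM) (one_pos.trans hN) hMN ha hb,
    fun _ _ J w hN hMN => hasSum_rpow_mul_phiExp J w (one_pos.trans hN) hMN⟩
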